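/- A lattice of dimension $d$ is a discrete subgroup $\Lambda$ of a Euclidean space that spans a $d$-dimensional subspace $V$; it is integral if $\langle u,v\rangle\in\mathbb Z$ for all $u,v\in\Lambda$. Its minimum is the smallest squared length $\langle v,v\rangle$ of a non-zero $v\in\Lambda$, and $\Lambda_{\min}$ is the set of non-zero vectors attaining it. The lattice $\Lambda$ is perfect if $\{v\otimes v : v\in\Lambda_{\min}\}$ spans the $\binom{d+1}{2}$-dimensional space of symmetric tensors in $V\otimes V$. Two lattices are isomorphic if a linear isometry between the spaces they span carries one onto the other. Theorem. For $d\in\mathbb N$ let $N(d)$ be the number of isomorphism classes of perfect integral lattices of dimension $d$ and minimum $4$. Then $N(d)$ is finite for every $d$, and $N(d)$ grows faster than any polynomial in $d$: for every real polynomial $P$, $P(d)=o(N(d))$ as $d\to\infty$. -/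

import Mathlib

open scoped TensorProduct

/-- A subset `S` of a real vector space `V` is perfect in `V` if the tensors `v ⊗ v` with `v ∈ S`
span the space of all symmetric tensors, which is the span of all `v ⊗ w + w ⊗ v`. -/
def IsPerfectSet {V : Type*} [AddCommGroup V] [Module ℝ V] (S : Set V) : Prop :=
  Submodule.span ℝ {t : V ⊗[ℝ] V | ∃ v ∈ S, t = v ⊗ₜ[ℝ] v} =
    Submodule.span ℝ {t : V ⊗[ℝ] V | ∃ v w : V, t = v ⊗ₜ[ℝ] w + w ⊗ₜ[ℝ] v}

/-- A (Euclidean) lattice of dimension `d`, realised in the Euclidean space that it spans: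
a discrete subgroup of `ℝ^d` which spans `ℝ^d`. -/
structure EuclideanLattice (d : ℕ) where
  /-- The underlying subgroup. -/
  carrier : Submodule ℤ (EuclideanSpace ℝ (Fin d))
  discrete : DiscreteTopology carrier
  isZLattice : IsZLattice ℝ carrier

namespace EuclideanLattice

variable {d : ℕ}

/-- All scalar products between lattice vectors are integers. -/
def IsIntegral (Λ : EuclideanLattice d) : Prop :=
  ∀ u ∈ Λ.carrier, ∀ v ∈ Λ.carrier, ∃ n : ℤ, inner ℝ u v = (n : ℝ)

/-- `m` is the minimum of `Λ`: the smallest squared length of a non-zero lattice vector. -/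
def HasMinimum (Λ : EuclideanLattice d) (m : ℝ) : Prop :=
  IsLeast {r : ℝ | ∃ v ∈ Λ.carrier, v ≠ 0 ∧ r = inner ℝ v v} m

/-- The set `Λ_min` of shortest non-zero vectors of `Λ`. -/
def minimalVectors (Λ : EuclideanLattice d) : Set (EuclideanSpace ℝ (Fin d)) :=
  {v | v ∈ Λ.carrier ∧ v ≠ 0 ∧ ∀ w ∈ Λ.carrier, w ≠ 0 → inner ℝ v v ≤ (inner ℝ w w : ℝ)}

/-- A lattice is perfect if its minimal vectors form a perfect set in the space it spans. -/
def IsPerfect (Λ : EuclideanLattice d) : Prop :=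
  IsPerfectSet Λ.minimalVectors

/-- Two lattices are isomorphic if a linear isometry maps one onto the other. -/
def Isomorphic (Λ M : EuclideanLattice d) : Prop :=
  ∃ f : EuclideanSpace ℝ (Fin d) ≃ₗᵢ[ℝ] EuclideanSpace ℝ (Fin d),
    f '' (Λ.carrier : Set (EuclideanSpace ℝ (Fin d))) = M.carrier

theorem isomorphic_equivalence : Equivalence (Isomorphic (d := d)) where
  refl Λ := ⟨LinearIsometryEquiv.refl ℝ _, by simp⟩
  symm := by
    rintro Λ M ⟨f, hf⟩
    refine ⟨f.symm, ?_⟩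
    rw [← hf, Set.image_image]
    simp
  trans := by
    rintro Λ M N ⟨f, hf⟩ ⟨g, hg⟩
    refine ⟨f.trans g, ?_⟩
    rw [← hg, ← hf, Set.image_image]
    rfl

end EuclideanLattice

/-- The perfect integral lattices of dimension `d` and minimum `4`. -/
def PerfectIntegralLatticeMinFour (d : ℕ) : Type :=
  {Λ : EuclideanLattice d // Λ.IsPerfect ∧ Λ.IsIntegral ∧ Λ.HasMinimum 4}

/-- Isomorphism of perfect integral lattices of dimension `d` and minimum `4`. -/
def perfectLatticeSetoid (d : ℕ) : Setoid (PerfectIntegralLatticeMinFour d) where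
  r Λ M := EuclideanLattice.Isomorphic Λ.1 M.1
  iseqv :=
    { refl := fun Λ => EuclideanLattice.isomorphic_equivalence.refl Λ.1
      symm := fun h => EuclideanLattice.isomorphic_equivalence.symm h
      trans := fun h h' => EuclideanLattice.isomorphic_equivalence.trans h h' }

/-- The isomorphism classes of perfect integral lattices of dimension `d` and minimum `4`. -/
def PerfectLatticeClasses (d : ℕ) : Type :=
  Quotient (perfectLatticeSetoid d)

/-! Growth. Let `C` be a binary code of length `d` and minimal weight at least 4. The integral
vectors reducing into `C` modulo 2 form an integral lattice of minimum 4, with `2e_i` among its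
shortest vectors. If moreover any two coordinates lie in the support of a word of weight 4, sign
changes in these words make the lattice perfect (`isPerfect_codeEuclideanLattice`). Such codes are
abundant: `blockCode` turns any code `D` of minimal weight at least 4 into one, and `D` can be
recovered from it (`map_fiberSum_blockCode`). Taking for `D` the words `(W t, t, t, t, t)` with `W`
an arbitrary `p × p` matrix, `p` about `d/40`, gives `2^(p²)` distinct lattices. An isometry between
two of them is determined by the images of the `2e_i`, which are integral vectors of squared length
4, so an isomorphism class contains at most `(2d+1)^(4d)` of them. This is negligible against
`2^(p²)`, and the quotient outgrows every power of `d`.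

Finiteness. The minimal vectors of a perfect lattice contain a basis of the space. Its Gram matrix
has integral entries in `[-4, 4]`, and the lattice lies between the span of this basis and the dual
of that span, so finitely many choices remain. -/

/-! ### Lattices from binary codes. -/

/-- The lattice of all integral vectors whose reduction modulo `2` belongs to the code `C`. -/
def codeLattice {d : ℕ} (C : Submodule (ZMod 2) (Fin d → ZMod 2)) :
    Submodule ℤ (EuclideanSpace ℝ (Fin d)) where
  carrier := {x | ∃ z : Fin d → ℤ, (∀ i, x i = z i) ∧ (fun i => (z i : ZMod 2)) ∈ C}
  add_mem' := by
    rintro x y ⟨z, hz, hzC⟩ ⟨w, hw, hwC⟩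
    refine ⟨z + w, fun i => by simp [hz, hw], ?_⟩
    convert C.add_mem hzC hwC using 1
    ext i; simp
  zero_mem' := ⟨0, by simp, by convert C.zero_mem using 1; ext i; simp⟩
  smul_mem' := by
    rintro n x ⟨z, hz, hzC⟩
    refine ⟨n • z, fun i => by simp [hz], ?_⟩
    convert C.smul_mem (n : ZMod 2) hzC using 1
    ext i; simp

theorem codeLattice_injective {d : ℕ} :
    Function.Injective (codeLattice (d := d)) := by
  have key : ∀ C C' : Submodule (ZMod 2) (Fin d → ZMod 2),
      codeLattice C ≤ codeLattice C' → C ≤ C' := by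
    intro C C' h c hc
    have h1 : (WithLp.toLp 2 (fun i => ((c i).val : ℝ)) : EuclideanSpace ℝ (Fin d)) ∈
        codeLattice C := ⟨fun i => ((c i).val : ℤ), by simp, by simpa using hc⟩
    obtain ⟨z, hz, hzC⟩ := h h1
    convert hzC using 1
    ext i
    have h2 : ((c i).val : ℝ) = z i := hz i
    have h3 : ((c i).val : ℤ) = z i := by exact_mod_cast h2
    rw [← h3]; simp
  intro C C' h
  exact le_antisymm (key _ _ h.le) (key _ _ h.ge)

theorem two_smul_single_mem_codeLattice {d : ℕ} (C : Submodule (ZMod 2) (Fin d → ZMod 2))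
    (i : Fin d) : (2 : ℝ) • EuclideanSpace.single i (1 : ℝ) ∈ codeLattice C := by
  refine ⟨Pi.single i 2, fun j => ?_, ?_⟩
  · by_cases h : j = i
    · subst h; simp
    · simp [h]
  · convert C.zero_mem using 1
    ext j
    by_cases h : j = i
    · subst h; simp; rfl
    · simp [h]

theorem inner_eq_intCast {d : ℕ} {x y : EuclideanSpace ℝ (Fin d)} {z w : Fin d → ℤ}
    (hz : ∀ i, x i = z i) (hw : ∀ i, y i = w i) :
    inner ℝ x y = ((∑ i, z i * w i : ℤ) : ℝ) := by
  simp [PiLp.inner_apply, hz, hw, mul_comm]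

instance discreteTopology_codeLattice {d : ℕ} (C : Submodule (ZMod 2) (Fin d → ZMod 2)) :
    DiscreteTopology (codeLattice C) := by
  have h : (codeLattice C : Set (EuclideanSpace ℝ (Fin d))) ⊆
      (Submodule.span ℤ (Set.range (EuclideanSpace.basisFun (Fin d) ℝ).toBasis) :
        Submodule ℤ (EuclideanSpace ℝ (Fin d))) := by
    rintro x ⟨z, hz, -⟩
    rw [SetLike.mem_coe, Module.Basis.mem_span_iff_repr_mem]
    intro i
    exact ⟨z i, by simp [hz]⟩
  exact DiscreteTopology.of_subset (t := (codeLattice C : Set (EuclideanSpace ℝ (Fin d))))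
    (inferInstanceAs (DiscreteTopology (Submodule.span ℤ
      (Set.range (EuclideanSpace.basisFun (Fin d) ℝ).toBasis)))) h

theorem isZLattice_codeLattice {d : ℕ} (C : Submodule (ZMod 2) (Fin d → ZMod 2)) :
    IsZLattice ℝ (codeLattice C) := by
  refine ⟨?_⟩
  rw [eq_top_iff, ← (EuclideanSpace.basisFun (Fin d) ℝ).toBasis.span_eq, Submodule.span_le]
  rintro _ ⟨i, rfl⟩
  have h := Submodule.smul_mem _ (1 / 2 : ℝ) (Submodule.subset_span (R := ℝ)
    (two_smul_single_mem_codeLattice C i))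
  rw [smul_smul] at h
  norm_num at h
  simpa using h

/-- The Euclidean lattice attached to a binary code by reduction modulo `2`. -/
def codeEuclideanLattice {d : ℕ} (C : Submodule (ZMod 2) (Fin d → ZMod 2)) :
    EuclideanLattice d where
  carrier := codeLattice C
  discrete := discreteTopology_codeLattice C
  isZLattice := isZLattice_codeLattice C

theorem isIntegral_codeEuclideanLattice {d : ℕ} (C : Submodule (ZMod 2) (Fin d → ZMod 2)) :
    (codeEuclideanLattice C).IsIntegral := by
  rintro u ⟨z, hz, -⟩ v ⟨w, hw, -⟩
  exact ⟨_, inner_eq_intCast hz hw⟩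

/-- If all entries are even, one non-zero entry already contributes 4. Otherwise the odd entries
form the support of a non-zero word, so there are at least four of them. -/
theorem four_le_inner_self_of_mem_codeLattice {d : ℕ} {C : Submodule (ZMod 2) (Fin d → ZMod 2)}
    (hC : ∀ c ∈ C, c ≠ 0 → 4 ≤ (Finset.univ.filter fun i => c i ≠ 0).card)
    {x : EuclideanSpace ℝ (Fin d)} (hx : x ∈ codeLattice C) (hx0 : x ≠ 0) :
    4 ≤ (inner ℝ x x : ℝ) := by
  obtain ⟨z, hz, hzC⟩ := hx
  rw [inner_eq_intCast hz hz]
  suffices h : (4 : ℤ) ≤ ∑ i, z i * z i by exact_mod_cast h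
  by_cases h0 : (fun i => (z i : ZMod 2)) = 0
  · obtain ⟨i, hi⟩ : ∃ i, z i ≠ 0 := by
      by_contra! h
      exact hx0 (by ext i; simp [hz, h])
    obtain ⟨k, hk⟩ := (ZMod.intCast_zmod_eq_zero_iff_dvd (z i) 2).1 (congrFun h0 i)
    refine le_trans ?_ (Finset.single_le_sum (f := fun i => z i * z i)
      (fun j _ => mul_self_nonneg _) (Finset.mem_univ i))
    have hk0 : k ≠ 0 := by rintro rfl; simp at hk; exact hi hk
    have : 1 ≤ k * k := Int.add_one_le_iff.2 (mul_self_pos.2 hk0)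
    push_cast at hk
    simp only [hk]
    linarith
  · calc (4 : ℤ) ≤ ((Finset.univ.filter fun i => (z i : ZMod 2) ≠ 0).card : ℤ) := by
          exact_mod_cast hC _ hzC h0
      _ = ∑ i, if (z i : ZMod 2) ≠ 0 then (1 : ℤ) else 0 := by
        rw [Finset.card_filter]; push_cast; rfl
      _ ≤ ∑ i, z i * z i := by
          refine Finset.sum_le_sum fun i _ => ?_
          split_ifs with h
          · exact Int.add_one_le_iff.2 (mul_self_pos.2 fun h' => h (by simp [h']))
          · exact mul_self_nonneg _

theorem inner_two_smul_single {d : ℕ} (i : Fin d) :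
    (inner ℝ ((2 : ℝ) • EuclideanSpace.single i (1 : ℝ))
      ((2 : ℝ) • EuclideanSpace.single i (1 : ℝ)) : ℝ) = 4 := by
  rw [inner_smul_left, inner_smul_right]
  norm_num

theorem hasMinimum_codeEuclideanLattice {d : ℕ} {C : Submodule (ZMod 2) (Fin d → ZMod 2)}
    (hd : 0 < d) (hC : ∀ c ∈ C, c ≠ 0 → 4 ≤ (Finset.univ.filter fun i => c i ≠ 0).card) :
    (codeEuclideanLattice C).HasMinimum 4 := by
  constructor
  · refine ⟨_, two_smul_single_mem_codeLattice C ⟨0, hd⟩, fun h => ?_,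
      (inner_two_smul_single _).symm⟩
    have := inner_two_smul_single (⟨0, hd⟩ : Fin d)
    rw [h] at this
    simp at this
  · rintro r ⟨v, hv, hv0, rfl⟩
    exact four_le_inner_self_of_mem_codeLattice hC hv hv0

theorem isPerfectSet_of_basis {V ι : Type*} [AddCommGroup V] [Module ℝ V]
    (b : Module.Basis ι ℝ V) (S : Set V)
    (h : ∀ i j, b i ⊗ₜ[ℝ] b j + b j ⊗ₜ[ℝ] b i ∈
      Submodule.span ℝ {t : V ⊗[ℝ] V | ∃ v ∈ S, t = v ⊗ₜ[ℝ] v}) : IsPerfectSet S := by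
  apply le_antisymm
  · rw [Submodule.span_le]
    rintro _ ⟨v, -, rfl⟩
    have h1 : (1 / 2 : ℝ) • (v ⊗ₜ[ℝ] v + v ⊗ₜ[ℝ] v) = v ⊗ₜ[ℝ] v := by
      rw [← two_smul ℝ, smul_smul]; norm_num
    rw [← h1]
    exact Submodule.smul_mem _ _ (Submodule.subset_span ⟨v, v, rfl⟩)
  · rw [Submodule.span_le]
    rintro _ ⟨v, w, rfl⟩
    let f : V →ₗ[ℝ] V →ₗ[ℝ] V ⊗[ℝ] V :=
      TensorProduct.mk ℝ V V + (TensorProduct.mk ℝ V V).flip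
    change f v w ∈ _
    rw [← b.linearCombination_repr v, ← b.linearCombination_repr w,
      Finsupp.linearCombination_apply, Finsupp.linearCombination_apply, Finsupp.sum, Finsupp.sum,
      map_sum]
    refine Submodule.sum_mem _ fun j _ => ?_
    rw [map_sum, LinearMap.sum_apply]
    refine Submodule.sum_mem _ fun i _ => ?_
    rw [map_smul, map_smul, LinearMap.smul_apply, smul_comm]
    exact Submodule.smul_mem _ _ (Submodule.smul_mem _ _ (h i j))

theorem signed_word_mem_codeLattice {d : ℕ} {C : Submodule (ZMod 2) (Fin d → ZMod 2)}
    {i j k l : Fin d}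
    (h : (Pi.single i 1 + Pi.single j 1 + (Pi.single k 1 + Pi.single l 1) : Fin d → ZMod 2) ∈ C)
    {s t : ℝ} (hs : s = 1 ∨ s = -1) (ht : t = 1 ∨ t = -1) :
    s • EuclideanSpace.single i (1 : ℝ) + t • EuclideanSpace.single j (1 : ℝ) +
      (EuclideanSpace.single k (1 : ℝ) + EuclideanSpace.single l (1 : ℝ)) ∈ codeLattice C := by
  have hs' : ∃ s' : ℤ, s = s' ∧ (s' : ZMod 2) = 1 := by
    rcases hs with rfl | rfl
    · exact ⟨1, by simp, by simp⟩
    · exact ⟨-1, by simp, by decide⟩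
  have ht' : ∃ t' : ℤ, t = t' ∧ (t' : ZMod 2) = 1 := by
    rcases ht with rfl | rfl
    · exact ⟨1, by simp, by simp⟩
    · exact ⟨-1, by simp, by decide⟩
  obtain ⟨s', rfl, hs'⟩ := hs'
  obtain ⟨t', rfl, ht'⟩ := ht'
  refine ⟨Pi.single i s' + Pi.single j t' + (Pi.single k 1 + Pi.single l 1), fun m => ?_, ?_⟩
  · simp [Pi.single_apply]
  · convert h using 1
    ext m
    simp [Pi.single_apply, apply_ite (Int.cast : ℤ → ZMod 2), hs', ht']

theorem isPerfect_codeEuclideanLattice {d : ℕ} {C : Submodule (ZMod 2) (Fin d → ZMod 2)}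
    (hC : ∀ c ∈ C, c ≠ 0 → 4 ≤ (Finset.univ.filter fun i => c i ≠ 0).card)
    (hpair : ∀ i j, i ≠ j → ∃ k l, k ≠ i ∧ k ≠ j ∧ l ≠ i ∧ l ≠ j ∧ k ≠ l ∧
      (Pi.single i 1 + Pi.single j 1 + (Pi.single k 1 + Pi.single l 1) : Fin d → ZMod 2) ∈ C) :
    (codeEuclideanLattice C).IsPerfect := by
  have hmin : ∀ v ∈ codeLattice C, (inner ℝ v v : ℝ) = 4 →
      v ∈ (codeEuclideanLattice C).minimalVectors := by
    intro v hv hv4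
    refine ⟨hv, ?_, fun w hw hw0 => ?_⟩
    · rintro rfl; simp at hv4
    · rw [hv4]; exact four_le_inner_self_of_mem_codeLattice hC hw hw0
  refine isPerfectSet_of_basis (EuclideanSpace.basisFun (Fin d) ℝ).toBasis _ fun i j => ?_
  simp only [OrthonormalBasis.coe_toBasis, EuclideanSpace.basisFun_apply]
  set e : Fin d → EuclideanSpace ℝ (Fin d) := fun i => EuclideanSpace.single i (1 : ℝ) with he
  change e i ⊗ₜ[ℝ] e j + e j ⊗ₜ[ℝ] e i ∈ _
  have hsp : ∀ v ∈ codeLattice C, (inner ℝ v v : ℝ) = 4 → v ⊗ₜ[ℝ] v ∈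
      Submodule.span ℝ {t : EuclideanSpace ℝ (Fin d) ⊗[ℝ] EuclideanSpace ℝ (Fin d) |
        ∃ v ∈ (codeEuclideanLattice C).minimalVectors, t = v ⊗ₜ[ℝ] v} := fun v hv hv4 =>
    Submodule.subset_span ⟨v, hmin v hv hv4, rfl⟩
  by_cases hij : i = j
  · subst hij
    have h1 := Submodule.smul_mem _ (1 / 2 : ℝ)
      (hsp _ (two_smul_single_mem_codeLattice C i) (inner_two_smul_single i))
    convert h1 using 1
    rw [TensorProduct.smul_tmul_smul, smul_smul, ← two_smul ℝ]
    norm_num [he]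
  · obtain ⟨k, l, hki, hkj, hli, hlj, hkl, hmem⟩ := hpair i j hij
    have hw : ∀ s t : ℝ, (s = 1 ∨ s = -1) → (t = 1 ∨ t = -1) →
        (s • e i + t • e j + (e k + e l)) ⊗ₜ[ℝ] (s • e i + t • e j + (e k + e l)) ∈
      Submodule.span ℝ {t : EuclideanSpace ℝ (Fin d) ⊗[ℝ] EuclideanSpace ℝ (Fin d) |
        ∃ v ∈ (codeEuclideanLattice C).minimalVectors, t = v ⊗ₜ[ℝ] v} := by
      intro s t hs ht
      refine hsp _ (signed_word_mem_codeLattice hmem hs ht) ?_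
      have hee : ∀ a b, (inner ℝ (e a) (e b) : ℝ) = if a = b then 1 else 0 := by
        intro a b
        simpa [he] using (orthonormal_iff_ite.1
          (EuclideanSpace.basisFun (Fin d) ℝ).orthonormal) a b
      have hs2 : s * s = 1 := by rcases hs with rfl | rfl <;> norm_num
      have ht2 : t * t = 1 := by rcases ht with rfl | rfl <;> norm_num
      simp only [inner_add_left, inner_add_right, real_inner_smul_left, real_inner_smul_right, hee,
        if_neg hij, if_neg (Ne.symm hij), if_neg hki, if_neg hkj, if_neg hli, if_neg hlj,
        if_neg hkl, if_neg hki.symm, if_neg hkj.symm, if_neg hli.symm, if_neg hlj.symm,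
        if_neg hkl.symm, if_true]
      linarith
    have h1 := hw 1 1 (by simp) (by simp)
    have h2 := hw 1 (-1) (by simp) (by simp)
    have h3 := hw (-1) 1 (by simp) (by simp)
    have h4 := hw (-1) (-1) (by simp) (by simp)
    -- Weighting the four sign choices by `s * t` isolates the mixed term: the sum is four times `e
    -- i ⊗ e j + e j ⊗ e i`.
    have h5 := Submodule.smul_mem _ (1 / 4 : ℝ)
      (Submodule.add_mem _ (Submodule.sub_mem _ (Submodule.sub_mem _ h1 h2) h3) h4)
    convert h5 using 1
    generalize e k + e l = u
    simp only [TensorProduct.add_tmul, TensorProduct.tmul_add, ← TensorProduct.smul_tmul',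
      TensorProduct.tmul_smul]
    module

/-! ### Codes on labelled blocks. -/

/-- The vector of sums of a word over the fibres of `f`. -/
def fiberSum {I B : Type*} [Fintype I] [DecidableEq B] (f : I → B) :
    (I → ZMod 2) →ₗ[ZMod 2] (B → ZMod 2) where
  toFun c b := ∑ i, if f i = b then c i else 0
  map_add' c c' := by
    ext b
    simp only [Pi.add_apply, ← Finset.sum_add_distrib]
    exact Finset.sum_congr rfl fun i _ => by split_ifs <;> simp
  map_smul' a c := by
    ext b
    simp only [Pi.smul_apply, RingHom.id_apply, Finset.smul_sum]
    exact Finset.sum_congr rfl fun i _ => by split_ifs <;> simp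

theorem fiberSum_apply {I B : Type*} [Fintype I] [DecidableEq B] (f : I → B)
    (c : I → ZMod 2) (b : B) : fiberSum f c b = ∑ i, if f i = b then c i else 0 := rfl

/-- For coordinates indexed by points of `B × 𝔽₂³`, the words whose sum over the blocks `{b} × 𝔽₂³`
belongs to `D` and whose sum of labels vanishes. -/
def blockCode {I B : Type*} [Fintype I] [DecidableEq B] (f : I → B × (Fin 3 → ZMod 2))
    (D : Submodule (ZMod 2) (B → ZMod 2)) : Submodule (ZMod 2) (I → ZMod 2) :=
  D.comap (fiberSum fun i => (f i).1) ⊓ LinearMap.ker (Fintype.linearCombination (ZMod 2)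
    fun i => (f i).2)

theorem mem_blockCode {I B : Type*} [Fintype I] [DecidableEq B] {f : I → B × (Fin 3 → ZMod 2)}
    {D : Submodule (ZMod 2) (B → ZMod 2)} {c : I → ZMod 2} :
    c ∈ blockCode f D ↔ fiberSum (fun i => (f i).1) c ∈ D ∧ ∑ i, c i • (f i).2 = 0 := by
  simp [blockCode, Fintype.linearCombination_apply]

theorem eq_one_of_ne_zero_zmod_two (a : ZMod 2) (h : a ≠ 0) : a = 1 := by
  revert a; decide

theorem add_eq_zero_iff_eq_zmod_two {I : Type*} (x y : I → ZMod 2) : x + y = 0 ↔ x = y := by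
  have h : ∀ a b : ZMod 2, a + b = 0 ↔ a = b := by decide
  simp [funext_iff, h]

/-- Zero block sums force even weight. In a word of weight 2 both coordinates would share block and
label, against injectivity of `f`. -/
theorem four_le_weight_of_fiberSum_eq_zero {I B : Type*} [Fintype I] [DecidableEq I] [Fintype B]
    [DecidableEq B] {f : I → B × (Fin 3 → ZMod 2)} (hf : Function.Injective f)
    {c : I → ZMod 2} (hc : fiberSum (fun i => (f i).1) c = 0) (hcl : ∑ i, c i • (f i).2 = 0)
    (hc0 : c ≠ 0) : 4 ≤ (Finset.univ.filter fun i => c i ≠ 0).card := by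
  set T := Finset.univ.filter fun i => c i ≠ 0 with hT
  have hc1 : ∀ i, c i = if i ∈ T then 1 else 0 := by
    intro i
    by_cases h : c i = 0
    · simp [hT, h]
    · simpa [hT, h] using eq_one_of_ne_zero_zmod_two _ h
  have hsum : ∑ i, c i = 0 := by
    have h1 : ∑ b, fiberSum (fun i => (f i).1) c b = 0 := by simp [hc]
    simp only [fiberSum_apply] at h1
    rw [Finset.sum_comm] at h1
    simpa using h1
  have heven : Even T.card := by
    rw [← ZMod.natCast_eq_zero_iff_even, ← hsum, Finset.sum_congr rfl fun i _ => hc1 i]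
    simp
  have hne : T.card ≠ 0 := by
    intro h
    rw [Finset.card_eq_zero] at h
    exact hc0 (funext fun i => by simp [hc1, h])
  have hne2 : T.card ≠ 2 := by
    intro h
    obtain ⟨i, j, hij, hTij⟩ := Finset.card_eq_two.1 h
    have hred : ∀ {M : Type} [AddCommMonoid M] (g : I → M), (∀ k, c k = 0 → g k = 0) →
        ∑ k, g k = g i + g j := by
      intro M _ g hg
      rw [← Finset.sum_pair hij, ← hTij]
      refine (Finset.sum_subset (Finset.subset_univ _) fun k _ hk => hg k ?_).symm
      simpa [hT] using hk
    have hi : c i = 1 := by simp [hc1, hTij]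
    have hj : c j = 1 := by simp [hc1, hTij]
    have hlab : (f i).2 = (f j).2 := by
      rw [hred _ (fun k hk => by simp [hk]), hi, hj, one_smul, one_smul] at hcl
      exact (add_eq_zero_iff_eq_zmod_two _ _).1 hcl
    have hblock : (f i).1 = (f j).1 := by
      have h1 := congrFun hc (f i).1
      rw [fiberSum_apply, hred _ (fun k hk => by simp [hk]), hi, hj] at h1
      by_contra hne
      simp [Ne.symm hne] at h1
    exact hij (hf (Prod.ext hblock hlab))
  obtain ⟨k, hk⟩ := heven
  omega

/-- Each block with non-zero sum contains a point of the support of `c`, so the weight of `c` is at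
least that of its block sums. -/
theorem four_le_weight_of_mem_blockCode {I B : Type*} [Fintype I] [DecidableEq I] [Fintype B]
    [DecidableEq B] {f : I → B × (Fin 3 → ZMod 2)} (hf : Function.Injective f)
    {D : Submodule (ZMod 2) (B → ZMod 2)}
    (hD : ∀ y ∈ D, y ≠ 0 → 4 ≤ (Finset.univ.filter fun b => y b ≠ 0).card)
    {c : I → ZMod 2} (hc : c ∈ blockCode f D) (hc0 : c ≠ 0) :
    4 ≤ (Finset.univ.filter fun i => c i ≠ 0).card := by
  obtain ⟨hcD, hcl⟩ := mem_blockCode.1 hc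
  by_cases hy0 : fiberSum (fun i => (f i).1) c = 0
  · exact four_le_weight_of_fiberSum_eq_zero hf hy0 hcl hc0
  · refine (hD _ hcD hy0).trans (le_trans (Finset.card_le_card (t := (Finset.univ.filter
      fun i => c i ≠ 0).image fun i => (f i).1) fun b hb => ?_) Finset.card_image_le)
    have hb' := (Finset.mem_filter.1 hb).2
    rw [fiberSum_apply] at hb'
    obtain ⟨i, -, hi⟩ := Finset.exists_ne_zero_of_sum_ne_zero hb'
    simp only [ne_eq, ite_eq_right_iff, Classical.not_imp] at hi
    exact Finset.mem_image.2 ⟨i, by simpa using hi.2, hi.1⟩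

theorem fiberSum_single {I B : Type*} [Fintype I] [DecidableEq I] [DecidableEq B] (f : I → B)
    (i : I) : fiberSum f (Pi.single i 1) = Pi.single (f i) 1 := by
  ext b
  rw [fiberSum_apply, Finset.sum_eq_single i]
  · by_cases h : f i = b
    · subst h; simp
    · simp [h, Ne.symm h]
  · intro j _ hj; simp [hj]
  · simp

theorem exists_word_of_pair {I B : Type*} [Fintype I] [DecidableEq I] [DecidableEq B]
    {f : I → B × (Fin 3 → ZMod 2)} (hf : Function.Injective f)
    (hf' : ∀ b a, a ≠ 0 → (b, a) ∈ Set.range f)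
    (D : Submodule (ZMod 2) (B → ZMod 2)) (i j : I) (hij : i ≠ j) :
    ∃ k l, k ≠ i ∧ k ≠ j ∧ l ≠ i ∧ l ≠ j ∧ k ≠ l ∧
      (Pi.single i 1 + Pi.single j 1 + (Pi.single k 1 + Pi.single l 1) : I → ZMod 2) ∈
        blockCode f D := by
  -- Four values are excluded among eight, hence labels in `𝔽₂³`. The word is completed by
  -- translating both labels by `h` within their blocks: `h ≠ x, y` keeps the new labels non-zero,
  -- hence available, while `h ≠ 0, x + y` keeps the new points away from `i` and `j`.
  have hh : ∀ x y : Fin 3 → ZMod 2, ∃ h : Fin 3 → ZMod 2, h ≠ 0 ∧ h ≠ x ∧ h ≠ y ∧ h ≠ x + y := by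
    decide
  obtain ⟨h, h0, hx, hy, hxy⟩ := hh (f i).2 (f j).2
  have hxx : ∀ x y : Fin 3 → ZMod 2, x + y = 0 ↔ x = y := add_eq_zero_iff_eq_zmod_two
  obtain ⟨k, hk⟩ := hf' (f i).1 ((f i).2 + h) (fun h' => hx ((hxx _ _).1 h').symm)
  obtain ⟨l, hl⟩ := hf' (f j).1 ((f j).2 + h) (fun h' => hy ((hxx _ _).1 h').symm)
  have hcancel : ∀ x y : Fin 3 → ZMod 2, x + h = y → h = x + y := by
    rintro x y rfl
    rw [← add_assoc, (hxx x x).2 rfl, zero_add]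
  refine ⟨k, l, ?_, ?_, ?_, ?_, ?_, mem_blockCode.2 ⟨?_, ?_⟩⟩
  · rintro rfl
    exact h0 (by simpa using congrArg Prod.snd hk)
  · rintro rfl
    exact hxy (hcancel _ _ (congrArg Prod.snd hk).symm)
  · rintro rfl
    exact hxy ((hcancel _ _ (congrArg Prod.snd hl).symm).trans (add_comm _ _))
  · rintro rfl
    exact h0 (by simpa using congrArg Prod.snd hl)
  · rintro rfl
    rw [hk] at hl
    have h1 := congrArg Prod.fst hl
    have h2 := congrArg Prod.snd hl
    exact hij (hf (Prod.ext h1 (add_right_cancel h2)))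
  · convert D.zero_mem using 1
    simp only [map_add, fiberSum_single, hk, hl]
    exact (add_eq_zero_iff_eq_zmod_two _ _).2 rfl
  · simp only [Pi.add_apply, add_smul, Finset.sum_add_distrib, Pi.single_apply, ite_smul, one_smul,
      zero_smul, Finset.sum_ite_eq', Finset.mem_univ, if_true, hk, hl]
    rw [hxx]; abel_nf
    rw [two_smul, (hxx h h).2 rfl, add_zero]

/-- The indicator function of a set of three non-zero labels with sum zero. -/
def labelTriangle (a : Fin 3 → ZMod 2) : ZMod 2 := if a 2 = 0 ∧ a ≠ 0 then 1 else 0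

theorem map_fiberSum_blockCode {I B : Type*} [Fintype I] [Fintype B] [DecidableEq B]
    {f : I → B × (Fin 3 → ZMod 2)} (hf : Function.Injective f)
    (hf' : ∀ b a, a ≠ 0 → (b, a) ∈ Set.range f) (D : Submodule (ZMod 2) (B → ZMod 2)) :
    (blockCode f D).map (fiberSum fun i => (f i).1) = D := by
  apply le_antisymm
  · rintro _ ⟨c, hc, rfl⟩
    exact (mem_blockCode.1 hc).1
  · intro y hy
    have hm0 : labelTriangle 0 = 0 := by decide
    have hm1 : ∑ a, labelTriangle a = 1 := by decide
    have hm2 : ∑ a, labelTriangle a • a = 0 := by decide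
    have hred : ∀ {M : Type} [AddCommMonoid M] (g : B × (Fin 3 → ZMod 2) → M),
        (∀ b, g (b, 0) = 0) → ∑ i, g (f i) = ∑ b, ∑ a, g (b, a) := by
      intro M _ g hg
      rw [← Fintype.sum_prod_type]
      refine Fintype.sum_of_injective f hf _ _ ?_ fun _ => rfl
      rintro ⟨b, a⟩ hba
      by_cases ha : a = 0
      · rw [ha, hg]
      · exact absurd (hf' b a ha) hba
    -- Lift of `y`: three points in each block where `y` is 1. Three is odd, so the block sums are
    -- `y`; the three labels cancel, and label 0, possibly missing, is avoided.
    set c : I → ZMod 2 := fun i => y (f i).1 * labelTriangle (f i).2 with hc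
    have h1 : fiberSum (fun i => (f i).1) c = y := by
      ext b
      rw [fiberSum_apply, hred (fun v => if v.1 = b then y v.1 * labelTriangle v.2 else 0)
        (fun b' => by simp [hm0]), Finset.sum_eq_single b]
      · simp [← Finset.mul_sum, hm1]
      · intro b' _ hb'; simp [hb']
      · simp
    refine ⟨c, mem_blockCode.2 ⟨h1.symm ▸ hy, ?_⟩, h1⟩
    rw [hred (fun v => (y v.1 * labelTriangle v.2) • v.2) (fun b => by simp)]
    simp only [mul_smul, ← Finset.smul_sum, hm2, smul_zero, Finset.sum_const_zero]

/-! ### A code for each matrix, and the lattices obtained. -/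

/-- The linear map sending `t` to `(W t, t, t, t, t)`. -/
def repeatedGraphMap {p : ℕ} (W : Matrix (Fin p) (Fin p) (ZMod 2)) :
    (Fin p → ZMod 2) →ₗ[ZMod 2] (Fin p × Option (Fin 4) → ZMod 2) where
  toFun t b := b.2.elim (W.mulVec t b.1) fun _ => t b.1
  map_add' t t' := by
    ext ⟨j, o⟩
    cases o <;> simp [Matrix.mulVec_add]
  map_smul' a t := by
    ext ⟨j, o⟩
    cases o <;> simp [Matrix.mulVec_smul]

/-- The code of all words `(W t, t, t, t, t)`. -/
def repeatedGraphCode {p : ℕ} (W : Matrix (Fin p) (Fin p) (ZMod 2)) :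
    Submodule (ZMod 2) (Fin p × Option (Fin 4) → ZMod 2) :=
  LinearMap.range (repeatedGraphMap W)

theorem repeatedGraphCode_injective {p : ℕ} :
    Function.Injective (repeatedGraphCode (p := p)) := by
  intro W W' h
  refine Matrix.mulVec_injective (funext fun t => ?_)
  have h1 : repeatedGraphMap W t ∈ repeatedGraphCode W' := h ▸ ⟨t, rfl⟩
  obtain ⟨t', ht'⟩ := h1
  have h2 : t' = t := funext fun j => congrFun ht' (j, some 0)
  subst h2
  exact funext fun j => (congrFun ht' (j, none)).symm

theorem four_le_weight_of_mem_repeatedGraphCode {p : ℕ} (W : Matrix (Fin p) (Fin p) (ZMod 2)) :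
    ∀ y ∈ repeatedGraphCode W, y ≠ 0 → 4 ≤ (Finset.univ.filter fun b => y b ≠ 0).card := by
  rintro _ ⟨t, rfl⟩ h0
  obtain ⟨j, hj⟩ : ∃ j, t j ≠ 0 := by
    by_contra! h
    exact h0 (by rw [show t = 0 from funext h, map_zero])
  have h1 : ((Finset.univ : Finset (Fin 4)).map
      ⟨fun s => ((j, some s) : Fin p × Option (Fin 4)), fun s s' h => by simpa using h⟩).card ≤
      (Finset.univ.filter fun b => repeatedGraphMap W t b ≠ 0).card := by
    refine Finset.card_le_card fun b hb => ?_
    obtain ⟨s, -, rfl⟩ := Finset.mem_map.1 hb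
    exact Finset.mem_filter.2 ⟨Finset.mem_univ _, hj⟩
  simpa using h1

/-- There are `5p` blocks, each with 7 compulsory labels and an optional label 0. This slack makes
every large `d` attainable. -/
theorem exists_block_labelling {p d : ℕ} (h1 : 35 * p ≤ d) (h2 : d ≤ 40 * p) :
    ∃ f : Fin d → (Fin p × Option (Fin 4)) × (Fin 3 → ZMod 2), Function.Injective f ∧
      ∀ b a, a ≠ 0 → (b, a) ∈ Set.range f := by
  classical
  set s : Finset ((Fin p × Option (Fin 4)) × (Fin 3 → ZMod 2)) :=
    Finset.univ ×ˢ Finset.univ.erase 0 with hs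
  have hscard : s.card = 35 * p := by
    simp [hs, Finset.card_product, Finset.card_erase_of_mem]
    ring
  have hcard : (Finset.univ : Finset ((Fin p × Option (Fin 4)) × (Fin 3 → ZMod 2))).card =
      40 * p := by
    simp
    ring
  obtain ⟨u, hsu, -, hu⟩ := Finset.exists_subsuperset_card_eq (Finset.subset_univ s)
    (hscard.trans_le h1) (h2.trans_eq hcard.symm)
  refine ⟨fun i => (u.equivFinOfCardEq hu).symm i, fun i j hij => ?_, fun b a ha => ?_⟩
  · exact (u.equivFinOfCardEq hu).symm.injective (Subtype.ext hij)
  · have : (b, a) ∈ u := hsu (by simp [hs, ha])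
    exact ⟨u.equivFinOfCardEq hu ⟨_, this⟩, by simp⟩

theorem exists_injective_codeLattice {p d : ℕ} (hd : 0 < d) (h1 : 35 * p ≤ d) (h2 : d ≤ 40 * p) :
    ∃ F : Matrix (Fin p) (Fin p) (ZMod 2) → PerfectIntegralLatticeMinFour d,
      ∀ W, ∃ C, (F W).1 = codeEuclideanLattice C ∧ ∀ W', (F W).1.carrier = (F W').1.carrier →
        W = W' := by
  obtain ⟨f, hf, hf'⟩ := exists_block_labelling h1 h2
  have hw := fun W : Matrix (Fin p) (Fin p) (ZMod 2) =>
    fun c => four_le_weight_of_mem_blockCode hf (four_le_weight_of_mem_repeatedGraphCode W) (c := c)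
  refine ⟨fun W => ⟨codeEuclideanLattice (blockCode f (repeatedGraphCode W)),
    isPerfect_codeEuclideanLattice (hw W) (exists_word_of_pair hf hf' _),
    isIntegral_codeEuclideanLattice _, hasMinimum_codeEuclideanLattice hd (hw W)⟩,
    fun W => ⟨_, rfl, fun W' h => ?_⟩⟩
  have h3 := codeLattice_injective h
  exact repeatedGraphCode_injective (by
    rw [← map_fiberSum_blockCode hf hf' (repeatedGraphCode W), h3, map_fiberSum_blockCode hf hf'])

/-! ### Finiteness of the number of classes. -/

/-- A functional `φ` vanishing on `S` makes `φ ⊗ φ` vanish on all symmetric tensors, so `φ(w)² = 0`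
for every `w`. -/
theorem span_eq_top_of_isPerfectSet {V : Type*} [AddCommGroup V] [Module ℝ V] {S : Set V}
    (hS : IsPerfectSet S) : Submodule.span ℝ S = ⊤ := by
  by_contra h
  obtain ⟨φ, hφ, hker⟩ := Submodule.exists_le_ker_of_lt_top _ (lt_top_iff_ne_top.2 h)
  refine hφ (LinearMap.ext fun w => ?_)
  let Φ : V ⊗[ℝ] V →ₗ[ℝ] ℝ := LinearMap.mul' ℝ ℝ ∘ₗ TensorProduct.map φ φ
  have h1 : Submodule.span ℝ {t : V ⊗[ℝ] V | ∃ v ∈ S, t = v ⊗ₜ[ℝ] v} ≤ LinearMap.ker Φ := by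
    rw [Submodule.span_le]
    rintro _ ⟨v, hv, rfl⟩
    have hv0 : φ v = 0 := hker (Submodule.subset_span hv)
    simp [Φ, hv0]
  have h2 : w ⊗ₜ[ℝ] w + w ⊗ₜ[ℝ] w ∈ LinearMap.ker Φ :=
    h1 (hS.symm ▸ Submodule.subset_span ⟨w, w, rfl⟩)
  simpa [Φ] using h2

namespace EuclideanLattice

variable {d : ℕ}

theorem IsPerfect.exists_basis {Λ : EuclideanLattice d} (hΛ : Λ.IsPerfect) :
    ∃ b : Module.Basis (Fin d) ℝ (EuclideanSpace ℝ (Fin d)), ∀ i, b i ∈ Λ.minimalVectors := by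
  let b := Module.Basis.ofSpan (span_eq_top_of_isPerfectSet hΛ).ge
  have hb := Module.Basis.ofSpan_subset (span_eq_top_of_isPerfectSet hΛ).ge
  have : Fintype _ := FiniteDimensional.fintypeBasisIndex b
  have e := Fintype.equivOfCardEq ((Module.finrank_eq_card_basis b).symm.trans (by simp) :
    Fintype.card _ = Fintype.card (Fin d))
  exact ⟨b.reindex e, fun i => hb ⟨e.symm i, by simp [b]⟩⟩

theorem inner_self_of_mem_minimalVectors {Λ : EuclideanLattice d} {m : ℝ} (hm : Λ.HasMinimum m)
    {v : EuclideanSpace ℝ (Fin d)} (hv : v ∈ Λ.minimalVectors) : (inner ℝ v v : ℝ) = m := by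
  obtain ⟨w, hw, hw0, rfl⟩ := hm.1
  exact le_antisymm (hv.2.2 w hw hw0) (hm.2 ⟨v, hv.1, hv.2.1, rfl⟩)

/-- The integral vectors of scalar products of the elements of `Λ` with the members of `b`. -/
def pairings (Λ : EuclideanLattice d) (b : Fin d → EuclideanSpace ℝ (Fin d)) : Set (Fin d → ℤ) :=
  {z | ∃ x ∈ Λ.carrier, ∀ i, inner ℝ x (b i) = (z i : ℝ)}

theorem map_mem_of_pairings_subset {Λ M : EuclideanLattice d} (hΛ : Λ.IsIntegral)
    {b b' : Module.Basis (Fin d) ℝ (EuclideanSpace ℝ (Fin d))} (hb : ∀ i, b i ∈ Λ.carrier)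
    (f : EuclideanSpace ℝ (Fin d) ≃ₗᵢ[ℝ] EuclideanSpace ℝ (Fin d)) (hf : ∀ i, f (b i) = b' i)
    (h : Λ.pairings b ⊆ M.pairings b') {x : EuclideanSpace ℝ (Fin d)} (hx : x ∈ Λ.carrier) :
    f x ∈ M.carrier := by
  choose z hz using fun i => hΛ x hx (b i) (hb i)
  obtain ⟨y, hy, hyz⟩ := h ⟨x, hx, hz⟩
  convert hy
  refine InnerProductSpace.ext_inner_right_basis b' fun i => ?_
  rw [hyz, ← hf, f.inner_map_map, hz]

theorem isomorphic_of_pairings_eq {Λ M : EuclideanLattice d} (hΛ : Λ.IsIntegral)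
    (hM : M.IsIntegral) {b b' : Module.Basis (Fin d) ℝ (EuclideanSpace ℝ (Fin d))}
    (hb : ∀ i, b i ∈ Λ.carrier) (hb' : ∀ i, b' i ∈ M.carrier)
    (hgram : ∀ i j, (inner ℝ (b i) (b j) : ℝ) = inner ℝ (b' i) (b' j))
    (h : Λ.pairings b = M.pairings b') : Λ.Isomorphic M := by
  let g := b.equiv b' (Equiv.refl _)
  have hg : ∀ i, g (b i) = b' i := fun i => by simp [g]
  have hinner : innerₗ (EuclideanSpace ℝ (Fin d)) =
      (innerₗ (EuclideanSpace ℝ (Fin d))).compl₁₂ g.toLinearMap g.toLinearMap := by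
    refine b.ext fun i => b.ext fun j => ?_
    simp [hg, hgram]
  let f := g.isometryOfInner fun x y =>
    (LinearMap.congr_fun (LinearMap.congr_fun hinner x) y).symm
  have hf : ∀ i, f (b i) = b' i := hg
  refine ⟨f, Set.Subset.antisymm ?_ fun y hy => ⟨f.symm y, ?_, f.apply_symm_apply y⟩⟩
  · rintro _ ⟨x, hx, rfl⟩
    exact map_mem_of_pairings_subset hΛ hb f hf h.le hx
  · exact map_mem_of_pairings_subset hM hb' f.symm (fun i => by rw [← hf]; simp) h.ge hy

theorem det_ne_zero_of_gram {b : Module.Basis (Fin d) ℝ (EuclideanSpace ℝ (Fin d))}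
    {G : Matrix (Fin d) (Fin d) ℤ} (hG : ∀ i j, inner ℝ (b i) (b j) = (G i j : ℝ)) :
    G.det ≠ 0 := by
  intro h
  obtain ⟨v, hv, hGv⟩ := Matrix.exists_mulVec_eq_zero_iff.2 h
  have h1 : ∑ j, (v j : ℝ) • b j = 0 := by
    refine InnerProductSpace.ext_inner_left_basis b fun i => ?_
    have h2 := congrFun hGv i
    simp only [Matrix.mulVec, dotProduct, Pi.zero_apply] at h2
    rw [inner_sum, inner_zero_right]
    simp only [inner_smul_right, hG]
    have h3 : ∑ j, (v j : ℝ) * (G i j : ℝ) = ((∑ j, G i j * v j : ℤ) : ℝ) := by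
      push_cast
      exact Finset.sum_congr rfl fun j _ => mul_comm _ _
    exact h3.trans (by rw [h2, Int.cast_zero])
  exact hv (funext fun j => by
    exact_mod_cast Fintype.linearIndependent_iff.1 b.linearIndependent _ h1 j)

/-- The integral combinations of `b` contribute the pairings `G ℤ^d`, which contain `det G • ℤ^d` by
the adjugate. Hence `pairings` is determined by its reduction modulo any multiple of `det G`. -/
theorem add_smul_mem_pairings {Λ : EuclideanLattice d} {b : Fin d → EuclideanSpace ℝ (Fin d)}
    (hb : ∀ i, b i ∈ Λ.carrier) {G : Matrix (Fin d) (Fin d) ℤ}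
    (hG : ∀ i j, inner ℝ (b i) (b j) = (G i j : ℝ)) {m : ℤ} (hm : G.det ∣ m) {z : Fin d → ℤ}
    (hz : z ∈ Λ.pairings b) (u : Fin d → ℤ) : z + m • u ∈ Λ.pairings b := by
  obtain ⟨x, hx, hxz⟩ := hz
  obtain ⟨k, rfl⟩ := hm
  set v := G.adjugate.mulVec (k • u) with hv
  have hGv : G.mulVec v = (G.det * k) • u := by
    rw [hv, Matrix.mulVec_mulVec, Matrix.mul_adjugate, Matrix.smul_mulVec, Matrix.one_mulVec,
      smul_smul]
  refine ⟨x + ∑ j, v j • b j,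
    Λ.carrier.add_mem hx (Submodule.sum_mem _ fun j _ => Submodule.smul_mem _ _ (hb j)),
    fun i => ?_⟩
  have h1 := congrFun hGv i
  simp only [Matrix.mulVec, dotProduct] at h1
  rw [Pi.add_apply, ← h1, inner_add_left, hxz, sum_inner]
  push_cast
  congr 1
  refine Finset.sum_congr rfl fun j _ => ?_
  rw [← Int.cast_smul_eq_zsmul ℝ, real_inner_smul_left, real_inner_comm, hG, mul_comm]

theorem exists_gram_of_hasMinimum_four {Λ : EuclideanLattice d} (hΛ : Λ.IsIntegral)
    (hm : Λ.HasMinimum 4) {b : Fin d → EuclideanSpace ℝ (Fin d)}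
    (hb : ∀ i, b i ∈ Λ.minimalVectors) :
    ∃ G : Fin d → Fin d → Finset.Icc (-4 : ℤ) 4,
      ∀ i j, inner ℝ (b i) (b j) = ((G i j : ℤ) : ℝ) := by
  have key : ∀ i j, ∃ n : Finset.Icc (-4 : ℤ) 4, inner ℝ (b i) (b j) = ((n : ℤ) : ℝ) := by
    intro i j
    obtain ⟨n, hn⟩ := hΛ _ (hb i).1 _ (hb j).1
    have hnorm : ∀ i, ‖b i‖ = 2 := fun i => by
      have h1 := inner_self_of_mem_minimalVectors hm (hb i)
      rw [real_inner_self_eq_norm_sq] at h1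
      nlinarith [norm_nonneg (b i)]
    have h2 := abs_real_inner_le_norm (b i) (b j)
    rw [hn, hnorm, hnorm, abs_le] at h2
    refine ⟨⟨n, Finset.mem_Icc.2 ⟨?_, ?_⟩⟩, hn⟩
    · exact_mod_cast (by linarith [h2.1] : (-4 : ℝ) ≤ n)
    · exact_mod_cast (by linarith [h2.2] : (n : ℝ) ≤ 4)
  choose G hG using key
  exact ⟨G, hG⟩

end EuclideanLattice

/-- A positive integer divisible by all non-zero determinants of `d × d` integral matrices with
entries between `-4` and `4`. -/
noncomputable def gramModulus (d : ℕ) : ℕ :=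
  ∏ G : Fin d → Fin d → Finset.Icc (-4 : ℤ) 4,
    if (Matrix.of fun i j => (G i j : ℤ)).det = 0 then 1
    else (Matrix.of fun i j => (G i j : ℤ)).det.natAbs

theorem gramModulus_ne_zero (d : ℕ) : gramModulus d ≠ 0 := by
  refine Finset.prod_ne_zero_iff.2 fun G _ => ?_
  split_ifs with h
  · exact one_ne_zero
  · exact Int.natAbs_ne_zero.2 h

theorem det_dvd_gramModulus {d : ℕ} (G : Fin d → Fin d → Finset.Icc (-4 : ℤ) 4)
    (h : (Matrix.of fun i j => (G i j : ℤ)).det ≠ 0) :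
    (Matrix.of fun i j => (G i j : ℤ)).det ∣ (gramModulus d : ℤ) := by
  rw [← Int.natAbs_dvd_natAbs, Int.natAbs_natCast]
  have := Finset.dvd_prod_of_mem (fun G : Fin d → Fin d → Finset.Icc (-4 : ℤ) 4 =>
    if (Matrix.of fun i j => (G i j : ℤ)).det = 0 then 1
    else (Matrix.of fun i j => (G i j : ℤ)).det.natAbs) (Finset.mem_univ G)
  rwa [if_neg h] at this

theorem finite_perfectLatticeClasses (d : ℕ) : Finite (PerfectLatticeClasses d) := by
  have : NeZero (gramModulus d) := ⟨gramModulus_ne_zero d⟩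
  choose b hb using fun Λ : PerfectIntegralLatticeMinFour d => Λ.2.1.exists_basis
  choose G hG using fun Λ : PerfectIntegralLatticeMinFour d =>
    EuclideanLattice.exists_gram_of_hasMinimum_four Λ.2.2.1 Λ.2.2.2 (hb Λ)
  let red : (Fin d → ℤ) → (Fin d → ZMod (gramModulus d)) := fun z i => z i
  have hred : ∀ (Λ : PerfectIntegralLatticeMinFour d) (z : Fin d → ℤ),
      red z ∈ red '' Λ.1.pairings (b Λ) → z ∈ Λ.1.pairings (b Λ) := by
    rintro Λ z ⟨w, hw, hwz⟩
    have hdvd : ∀ i, ∃ k : ℤ, z i - w i = gramModulus d * k := fun i =>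
      (ZMod.intCast_eq_intCast_iff_dvd_sub _ _ _).1 (congrFun hwz i)
    choose u hu using hdvd
    have h1 := EuclideanLattice.add_smul_mem_pairings (fun i => (hb Λ i).1)
      (G := Matrix.of fun i j => (G Λ i j : ℤ)) (hG Λ)
      (det_dvd_gramModulus (G Λ) (EuclideanLattice.det_ne_zero_of_gram (hG Λ))) hw u
    convert h1 using 1
    ext i
    simp [← hu]
  have hiso : ∀ Λ M : PerfectIntegralLatticeMinFour d, G Λ = G M →
      red '' Λ.1.pairings (b Λ) = red '' M.1.pairings (b M) →
      EuclideanLattice.Isomorphic Λ.1 M.1 := by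
    intro Λ M h1 h2
    refine EuclideanLattice.isomorphic_of_pairings_eq Λ.2.2.1 M.2.2.1 (fun i => (hb Λ i).1)
      (fun i => (hb M i).1) (fun i j => by rw [hG, hG, h1]) ?_
    ext z
    exact ⟨fun hz => hred M z (h2 ▸ ⟨z, hz, rfl⟩), fun hz => hred Λ z (h2 ▸ ⟨z, hz, rfl⟩)⟩
  -- The modulus depends only on `d`, so the Gram matrix and the reduced pairings take values in one
  -- finite set.
  refine Finite.of_injective (β := (Fin d → Fin d → Finset.Icc (-4 : ℤ) 4) ×
    Set (Fin d → ZMod (gramModulus d)))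
    (fun q => (G (Quotient.out q), red '' (Quotient.out q).1.pairings (b (Quotient.out q))))
    fun q q' h => ?_
  rw [Prod.mk.injEq] at h
  exact (Quotient.out_eq q).symm.trans
    ((Quotient.sound (s := perfectLatticeSetoid d) (hiso _ _ h.1 h.2)).trans (Quotient.out_eq q'))

/-! ### Counting isomorphic copies, and growth. -/

-- Since `|n| ≤ n²` for integers, such a vector has `ℓ¹`-norm at most 4 and is a sum of four
-- elements of `{0, ±e_i}`.
open scoped Pointwise in
theorem exists_finset_integral_vectors (d : ℕ) :
    ∃ X : Finset (Fin d → ℤ), X.card ≤ (2 * d + 1) ^ 4 ∧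
      ∀ z : Fin d → ℤ, ∑ i, z i * z i = 4 → z ∈ X := by
  classical
  set U : Finset (Fin d → ℤ) := insert 0 ((Finset.univ.image fun i => Pi.single i 1) ∪
    Finset.univ.image fun i => Pi.single i (-1)) with hU
  have hUcard : U.card ≤ 2 * d + 1 := by
    refine (Finset.card_insert_le _ _).trans (Nat.succ_le_succ ?_)
    refine (Finset.card_union_le _ _).trans ?_
    rw [two_mul]
    exact add_le_add (Finset.card_image_le.trans (by simp)) (Finset.card_image_le.trans (by simp))
  have hmem : ∀ (k : ℕ) (z : Fin d → ℤ), ∑ i, |z i| ≤ k → z ∈ k • U := by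
    intro k
    induction k with
    | zero =>
      intro z hz
      have h0 : ∀ i, z i = 0 := fun i => abs_eq_zero.1 <| le_antisymm
        ((Finset.single_le_sum (f := fun i => |z i|) (fun j _ => abs_nonneg _)
          (Finset.mem_univ i)).trans (by simpa using hz)) (abs_nonneg _)
      rw [zero_smul, Finset.mem_zero]
      exact funext h0
    | succ k ih =>
      intro z hz
      rw [succ_nsmul]
      by_cases h0 : z = 0
      · rw [h0, ← add_zero (0 : Fin d → ℤ)]
        exact Finset.add_mem_add (ih 0 (by simp)) (by simp [hU])
      · obtain ⟨i, hi⟩ := Function.ne_iff.1 h0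
        have hs : ∃ s : ℤ, (s = 1 ∨ s = -1) ∧ |z i - s| = |z i| - 1 := by
          simp only [Pi.zero_apply] at hi
          rcases lt_or_gt_of_ne hi with h | h
          · exact ⟨-1, Or.inr rfl, by rw [abs_of_neg h, abs_of_nonpos (by omega)]; ring⟩
          · exact ⟨1, Or.inl rfl, by rw [abs_of_pos h, abs_of_nonneg (by omega)]⟩
        obtain ⟨s, hs, hzs⟩ := hs
        have hsU : Pi.single i s ∈ U := by
          rcases hs with rfl | rfl <;> simp [hU]
        rw [← sub_add_cancel z (Pi.single i s)]
        refine Finset.add_mem_add (ih _ ?_) hsU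
        rw [← Finset.add_sum_erase _ _ (Finset.mem_univ i)] at hz ⊢
        have h1 : ∑ j ∈ Finset.univ.erase i, |(z - Pi.single i s : Fin d → ℤ) j| =
            ∑ j ∈ Finset.univ.erase i, |z j| :=
          Finset.sum_congr rfl fun j hj => by simp [Finset.ne_of_mem_erase hj]
        rw [h1, Pi.sub_apply, Pi.single_eq_same, hzs]
        push_cast at hz
        linarith
  refine ⟨4 • U, Finset.card_nsmul_le.trans (Nat.pow_le_pow_left hUcard 4), fun z hz => ?_⟩
  refine hmem 4 z (le_trans (Finset.sum_le_sum fun i _ => ?_) hz.le)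
  rw [← abs_mul_abs_self]
  nlinarith [abs_nonneg (z i), Int.le_self_sq |z i|]

theorem card_matrices_le_card_classes {p d : ℕ} (hd : 0 < d) (h1 : 35 * p ≤ d)
    (h2 : d ≤ 40 * p) :
    2 ^ (p * p) ≤ ((2 * d + 1) ^ 4) ^ d * Nat.card (PerfectLatticeClasses d) := by
  classical
  obtain ⟨F, hF⟩ := exists_injective_codeLattice hd h1 h2
  obtain ⟨X, hX, hmem⟩ := exists_finset_integral_vectors d
  have := finite_perfectLatticeClasses d
  have := Fintype.ofFinite (PerfectLatticeClasses d)
  let κ : PerfectIntegralLatticeMinFour d → PerfectLatticeClasses d :=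
    Quotient.mk (perfectLatticeSetoid d)
  have hfiber : ∀ q ∈ (Finset.univ : Finset (PerfectLatticeClasses d)),
      (Finset.univ.filter fun W => κ (F W) = q).card ≤ ((2 * d + 1) ^ 4) ^ d := by
    rintro q -
    rcases (Finset.univ.filter fun W => κ (F W) = q).eq_empty_or_nonempty with h0 | ⟨W₀, hW₀⟩
    · rw [h0]; simp
    have hiso : ∀ W : {W // W ∈ Finset.univ.filter fun W => κ (F W) = q},
        EuclideanLattice.Isomorphic (F W).1 (F W₀).1 := fun W =>
      Quotient.exact (s := perfectLatticeSetoid d)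
        ((Finset.mem_filter.1 W.2).2.trans (Finset.mem_filter.1 hW₀).2.symm)
    choose f hf using hiso
    have hframe : ∀ W i, ∃ z : X, ∀ j,
        f W ((2 : ℝ) • EuclideanSpace.single i (1 : ℝ)) j = (z.1 j : ℝ) := by
      intro W i
      obtain ⟨C, hC, -⟩ := hF W.1
      obtain ⟨C₀, hC₀, -⟩ := hF W₀
      have h3 : f W ((2 : ℝ) • EuclideanSpace.single i (1 : ℝ)) ∈ codeLattice C₀ := by
        change _ ∈ (codeEuclideanLattice C₀).carrier
        rw [← hC₀, ← SetLike.mem_coe, ← hf W, hC]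
        exact ⟨_, two_smul_single_mem_codeLattice C i, rfl⟩
      obtain ⟨z, hz, -⟩ := h3
      refine ⟨⟨z, hmem z ?_⟩, hz⟩
      have h4 := inner_eq_intCast hz hz
      rw [(f W).inner_map_map, inner_two_smul_single] at h4
      exact_mod_cast h4.symm
    choose z hz using hframe
    -- The frame images determine the isometry onto the fixed lattice of `W₀`; its inverse then
    -- recovers the lattice of `W`, hence `W`.
    have hinj : Function.Injective z := by
      intro W W' h
      have hff : f W = f W' := by
        apply LinearIsometryEquiv.toLinearEquiv_injective
        refine LinearEquiv.toLinearMap_injective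
          ((EuclideanSpace.basisFun (Fin d) ℝ).toBasis.ext fun i => ?_)
        have h3 : f W ((2 : ℝ) • EuclideanSpace.single i (1 : ℝ)) =
            f W' ((2 : ℝ) • EuclideanSpace.single i (1 : ℝ)) := by
          ext j
          rw [hz, hz, h]
        rw [map_smul, map_smul] at h3
        simpa using smul_right_injective _ (two_ne_zero (α := ℝ)) h3
      obtain ⟨-, -, hW⟩ := hF W.1
      refine Subtype.ext (hW _ (SetLike.coe_injective ((f W).injective.image_injective ?_)))
      rw [hf W, hff, hf W']
    have h3 := Fintype.card_le_of_injective z hinj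
    rw [Fintype.card_coe, Fintype.card_fun, Fintype.card_coe, Fintype.card_fin] at h3
    exact h3.trans (Nat.pow_le_pow_left hX d)
  have h3 := Finset.card_le_mul_card_image_of_maps_to (s := Finset.univ)
    (t := (Finset.univ : Finset (PerfectLatticeClasses d))) (f := fun W => κ (F W))
    (fun _ _ => Finset.mem_univ _) _ hfiber
  rw [Finset.card_univ, Finset.card_univ, ← Nat.card_eq_fintype_card (α := PerfectLatticeClasses d)]
    at h3
  convert h3 using 1
  rw [← Fintype.card_congr (Matrix.of (m := Fin p) (n := Fin p) (α := ZMod 2))]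
  simp [pow_mul]

theorem eventually_pow_le_card_perfectLatticeClasses (k : ℕ) :
    ∀ᶠ d in Filter.atTop, d ^ k ≤ Nat.card (PerfectLatticeClasses d) := by
  -- For `d ≤ 40p` one has `2d + 1 ≤ 81p` and `5d ≤ 200p`, where `5d` is `4d` for the frames plus
  -- `d` to absorb `d^k`.
  have hlim := tendsto_pow_const_div_const_pow_of_one_lt 200 (one_lt_two (α := ℝ))
  have hp : ∀ᶠ p : ℕ in Filter.atTop, (81 * p) ^ 200 ≤ 2 ^ p := by
    filter_upwards [hlim.eventually (gt_mem_nhds (show (0 : ℝ) < 1 / 81 ^ 200 by positivity))]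
      with p hp
    rw [div_lt_div_iff₀ (by positivity) (by positivity), one_mul] at hp
    rw [mul_pow, mul_comm]
    exact_mod_cast hp.le
  obtain ⟨p₀, hp₀⟩ := Filter.eventually_atTop.1 hp
  -- With `p = ⌈d/40⌉`, the bound `35p ≤ d` follows from `35(d + 39) ≤ 40d`, that is `d ≥ 273`.
  filter_upwards [Filter.eventually_ge_atTop (40 * p₀ + 273 + k)] with d hd
  obtain ⟨p, hpd⟩ : ∃ p, p = (d + 39) / 40 := ⟨_, rfl⟩
  have h1 := card_matrices_le_card_classes (p := p) (d := d) (by omega) (by omega) (by omega)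
  have h2 := hp₀ p (by omega)
  have h3 : (2 * d + 1) ^ (5 * d) ≤ 2 ^ (p * p) :=
    calc (2 * d + 1) ^ (5 * d) ≤ (81 * p) ^ (5 * d) := Nat.pow_le_pow_left (by omega) _
      _ ≤ (81 * p) ^ (200 * p) := Nat.pow_le_pow_right (by omega) (by omega)
      _ = ((81 * p) ^ 200) ^ p := pow_mul _ _ _
      _ ≤ (2 ^ p) ^ p := Nat.pow_le_pow_left h2 _
      _ = 2 ^ (p * p) := (pow_mul _ _ _).symm
  have h4 : ((2 * d + 1) ^ 4) ^ d * d ^ k ≤ (2 * d + 1) ^ (5 * d) :=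
    calc ((2 * d + 1) ^ 4) ^ d * d ^ k ≤ ((2 * d + 1) ^ 4) ^ d * (2 * d + 1) ^ d := by
          refine Nat.mul_le_mul_left _ ((Nat.pow_le_pow_left (by omega) k).trans
            (Nat.pow_le_pow_right (by omega) (by omega)))
      _ = (2 * d + 1) ^ (5 * d) := by rw [← pow_mul, ← pow_add]; congr 1; ring
  exact Nat.le_of_mul_le_mul_left ((h4.trans h3).trans h1) (by positivity)

theorem theorem2p6 :
    (∀ d : ℕ, Finite (PerfectLatticeClasses d)) ∧
      ∀ P : Polynomial ℝ,
        (fun d : ℕ => P.eval (d : ℝ)) =o[Filter.atTop]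
          (fun d : ℕ => (Nat.card (PerfectLatticeClasses d) : ℝ)) := by
  refine ⟨finite_perfectLatticeClasses, fun P => ?_⟩
  have h1 : P.degree < (Polynomial.X ^ (P.natDegree + 1) : Polynomial ℝ).degree := by
    rw [Polynomial.degree_X_pow]
    exact Polynomial.degree_le_natDegree.trans_lt (by exact_mod_cast Nat.lt_succ_self _)
  have h2 := (Polynomial.isLittleO_atTop_of_degree_lt P _ h1).comp_tendsto
    (tendsto_natCast_atTop_atTop (R := ℝ))
  refine h2.trans_isBigO (Asymptotics.IsBigO.of_bound 1 ?_)
  filter_upwards [eventually_pow_le_card_perfectLatticeClasses (P.natDegree + 1)] with d hd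
  simp only [Function.comp_apply, Polynomial.eval_pow, Polynomial.eval_X, one_mul, norm_pow,
    Real.norm_natCast]
  exact_mod_cast hd
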